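/- Let $K_{k+1}$ be the complete graph with non-sink vertices $v_1,\dots,v_k$ and sink $s$. A sandpile on $K_{k+1}$ is a function $c:\{v_1,\dots,v_k\}\to\mathbb{Z}_{\ge 0}$. A vertex $v_i$ with $c(v_i)\ge k$ is unstable and may topple, which removes $k$ grains from $v_i$ and adds one grain to every other non-sink vertex; $c$ is stable if no vertex is unstable. Every sandpile $a$ can be turned into a unique stable sandpile $a^\circ$ by toppling unstable vertices, and the number of times each vertex topples does not depend on the order. A stable sandpile $c$ is recurrent if for every sandpile $a$ there is a sandpile $b$ with $(a+b)^\circ=c$; let $\mathscr{S}(K_{k+1})$ be the set of recurrent sandpiles. Let $n\ge 0$. For $c\in\mathscr{S}(K_{n+1})$ and a non-sink vertex $v$, the principal avalanche of $c$ at $v$ is the stabilization of $c+1_v$; let $\nu(c,v)=(f_1,\dots,f_n)$, where $f_i$ is the number of times $v_i$ topples in it. Its size is $f_1+\dots+f_n$. Let $\lambda_m$ be the number of pairs $(c,v)$ whose principal avalanche has size $m$, and let $\mathscr{A}_{K_{n+1}}(x_1,\dots,x_n)=\sum_{c\in\mathscr{S}(K_{n+1})}\sum_{v}\prod_{i=1}^n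 x_i^{\nu(c,v)_i}$ be the multivariate avalanche polynomial. Then $$\mathscr{A}_{K_{n+1}}(x_1,\dots,x_n)=\sum_{m=0}^n\frac{\lambda_m}{\binom nm}\,e_m(x_1,\dots,x_n),$$ where $e_m$ is the $m$-th elementary symmetric polynomial. Moreover, for every $1\le m\le n$ the following hold. (a) There is a well-defined bijection $\phi$ from the set of pairs $(c,v)$ whose principal avalanche has size $m$ onto the set of tuples $(v,J,c_1,c_2)$, where $v$ is a non-sink vertex of $K_{n+1}$, $J$ is a set of $m-1$ non-sink vertices different from $v$, $c_1\in\mathscr{S}(K_m)$ and $c_2\in\mathscr{S}(K_{n-m+1})$. It is given by $\phi(c,v)=(v,J,c_1,c_2)$, where $J$ is the set of vertices other than $v$ that topple in the principal avalanche of $c$ at $v$, $c_1$ is the list of the values $c(w)-(n-m+1)$ for $w\in J$, and $c_2$ is the list of the values $c(w)$ for the non-sink vertices $w\notin J\cup\{v\}$, both in increasing order of the index of $w$. (b) $$\lambda_m=\binom nm\, m^{m-1}(n-m+1)^{n-m-1}.$$ -/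

import Mathlib

/-- A finite connected undirected multigraph without loops, with a distinguished sink.
The non-sink vertices are the elements of `W`, the vertex set is `Option W`, and the sink is
`none`. `weight u v` is the number of edges between `u` and `v`. -/
structure SinkGraph (W : Type*) where
  weight : Option W → Option W → ℕ
  weight_symm : ∀ u v, weight u v = weight v u
  weight_self : ∀ u, weight u u = 0
  connected : (SimpleGraph.fromRel fun u v => 0 < weight u v).Connected

namespace SinkGraph

variable {W : Type*} [Fintype W] [DecidableEq W] (G : SinkGraph W)

/-- The degree of a non-sink vertex (edges to the sink are counted). -/
def deg (v : W) : ℕ := ∑ u : Option W, G.weight (some v) u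

/-- A sandpile `c : W → ℕ` is stable if `c v < d_v` for every non-sink vertex `v`. -/
def IsStable (c : W → ℕ) : Prop := ∀ v, c v < G.deg v

/-- The sandpile obtained from `c` by toppling `v` (used only when `d_v ≤ c v`). -/
def topple (c : W → ℕ) (v : W) : W → ℕ :=
  fun w => if w = v then c v - G.deg v else c w + G.weight (some v) (some w)

/-- `G.Topples c l c'`: starting from `c` one may topple successively the vertices in the list
`l`, each of them being unstable when it topples, and the result is `c'`. -/
inductive Topples : (W → ℕ) → List W → (W → ℕ) → Prop
  | nil (c : W → ℕ) : Topples c [] c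
  | cons {c c' : W → ℕ} {v : W} {l : List W} (hv : G.deg v ≤ c v)
      (h : Topples (G.topple c v) l c') : Topples c (v :: l) c'

/-- `c'` is the stabilization of `c`. -/
def Stabilizes (c c' : W → ℕ) : Prop := (∃ l, G.Topples c l c') ∧ G.IsStable c'

/-- `f` records how often each vertex topples in a stabilization of `c`. -/
def IsTopplingVector (c f : W → ℕ) : Prop :=
  ∃ l c', G.Topples c l c' ∧ G.IsStable c' ∧ ∀ w, f w = l.count w

/-- A sandpile `c` is recurrent if it is stable and for every sandpile `a` there is a
sandpile `b` such that `a + b` stabilizes to `c`. -/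
def IsRecurrent (c : W → ℕ) : Prop :=
  G.IsStable c ∧ ∀ a : W → ℕ, ∃ b : W → ℕ, G.Stabilizes (a + b) c

/-! ### Existence and uniqueness of the toppling vector of a stabilization -/

theorem topple_unstable {c : W → ℕ} {u v : W} (h : u ≠ v) (hv : G.deg v ≤ c v) :
    G.deg v ≤ G.topple c u v := by
  simp only [topple, if_neg h.symm]
  omega

theorem topple_comm {c : W → ℕ} {u v : W} (h : u ≠ v) (hu : G.deg u ≤ c u)
    (hv : G.deg v ≤ c v) : G.topple (G.topple c u) v = G.topple (G.topple c v) u := by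
  funext w
  by_cases h1 : w = u
  · subst h1
    simp only [topple, if_neg h, if_neg h.symm, if_true]
    omega
  · by_cases h2 : w = v
    · subst h2
      simp only [topple, if_neg h.symm, if_true]
      omega
    · simp only [topple, if_neg h1, if_neg h2]
      omega

theorem le_of_topples {c c' : W → ℕ} {l : List W} {v : W} (h : G.Topples c l c')
    (hv : v ∉ l) : c v ≤ c' v := by
  induction h with
  | nil c => exact le_rfl
  | @cons c c' u l hu h ih =>
    rw [List.mem_cons, not_or] at hv
    refine le_trans ?_ (ih hv.2)
    simp only [topple, if_neg hv.1]
    omega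

theorem topples_erase {c c' : W → ℕ} {l : List W} {v : W} (h : G.Topples c l c')
    (hv : v ∈ l) (hc : G.deg v ≤ c v) : G.Topples (G.topple c v) (l.erase v) c' := by
  induction h with
  | nil c => simp at hv
  | @cons c c' u l hu h ih =>
    by_cases huv : u = v
    · subst huv
      simpa using h
    · rw [List.erase_cons_tail (by simpa using huv)]
      have hvl : v ∈ l := by
        rcases List.mem_cons.1 hv with h' | h'
        · exact absurd h'.symm huv
        · exact h'
      refine Topples.cons (G.topple_unstable (Ne.symm huv) hu) ?_
      rw [← G.topple_comm huv hu hc]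
      exact ih hvl (G.topple_unstable huv hc)

theorem topples_count_le {c c₁ c₂ : W → ℕ} {l l' : List W} (h : G.Topples c l c₁)
    (h' : G.Topples c l' c₂) (hs : G.IsStable c₂) (w : W) : l.count w ≤ l'.count w := by
  induction h generalizing l' with
  | nil c => simp
  | @cons c c₁ v l hv h ih =>
    have hm : v ∈ l' := by
      by_contra hn
      exact absurd (hs v) (not_lt.2 (hv.trans (G.le_of_topples h' hn)))
    have := ih (G.topples_erase h' hm hv)
    rw [(List.perm_cons_erase hm).count_eq w, List.count_cons, List.count_cons]
    omega

/-- A potential on the vertices which strictly decreases in the mean under each toppling. -/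
theorem exists_potential : ∃ h : W → ℤ, (∀ v, 0 ≤ h v) ∧
    ∀ v, ∑ w : W, (G.weight (some v) (some w) : ℤ) * h w < G.deg v * h v := by
  classical
  let S := SimpleGraph.fromRel fun u v => 0 < G.weight u v
  let d : Option W → ℕ := fun u => S.dist u none
  let D : ℕ := ∑ u : Option W, d u
  let B : ℤ := 1 + ∑ v : W, (G.deg v : ℤ)
  have hB : 1 ≤ B := by
    have : (0 : ℤ) ≤ ∑ v : W, (G.deg v : ℤ) := Finset.sum_nonneg fun _ _ => by positivity
    simp only [B]
    omega
  have hd : ∀ u, d u ≤ D := fun u =>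
    Finset.single_le_sum (f := d) (fun _ _ => Nat.zero_le _) (Finset.mem_univ u)
  let g : Option W → ℤ := fun u => B ^ (D - d u)
  have hg : ∀ u, 0 ≤ g u := fun u => by positivity
  refine ⟨fun w => B ^ D - g (some w), fun v => ?_, fun v => ?_⟩
  · exact sub_nonneg.2 (pow_le_pow_right₀ hB (Nat.sub_le _ _))
  · have key : (G.deg v : ℤ) * g (some v) < ∑ u : Option W, (G.weight (some v) u : ℤ) * g u := by
      obtain ⟨p, hp⟩ := G.connected.exists_walk_length_eq_dist (some v) none
      cases p with
      | @cons _ u _ hadj q =>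
        have hdu : d u + 1 ≤ d (some v) := by
          have h1 : d u ≤ q.length := SimpleGraph.dist_le q
          have h2 : q.length + 1 = d (some v) := hp
          omega
        have hw : 1 ≤ G.weight (some v) u := by
          rw [SimpleGraph.fromRel_adj] at hadj
          rcases hadj.2 with h | h
          · exact h
          · rw [G.weight_symm]
            exact h
        have h3 : B * g (some v) ≤ g u := by
          have : B * g (some v) = B ^ (D - d (some v) + 1) := by
            simp only [g]
            ring
          rw [this]
          refine pow_le_pow_right₀ hB ?_
          have := hd (some v)
          omega
        have h4 : (G.weight (some v) u : ℤ) * g u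
            ≤ ∑ u : Option W, (G.weight (some v) u : ℤ) * g u :=
          Finset.single_le_sum (f := fun u => (G.weight (some v) u : ℤ) * g u)
            (fun i _ => mul_nonneg (by positivity) (hg i)) (Finset.mem_univ u)
        have h5 : (G.deg v : ℤ) < B := by
          have : (G.deg v : ℤ) ≤ ∑ v : W, (G.deg v : ℤ) :=
            Finset.single_le_sum (f := fun v => (G.deg v : ℤ)) (fun _ _ => by positivity)
              (Finset.mem_univ v)
          simp only [B]
          omega
        have h6 : 0 < g (some v) := by positivity
        have h7 : g u ≤ (G.weight (some v) u : ℤ) * g u :=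
          le_mul_of_one_le_left (hg u) (by exact_mod_cast hw)
        calc (G.deg v : ℤ) * g (some v) < B * g (some v) := mul_lt_mul_of_pos_right h5 h6
          _ ≤ _ := h3.trans (h7.trans h4)
    have hnone : g none = B ^ D := by
      have : d none = 0 := SimpleGraph.dist_self
      simp only [g, this, Nat.sub_zero]
    have hdeg : (G.deg v : ℤ) = G.weight (some v) none
        + ∑ w : W, (G.weight (some v) (some w) : ℤ) := by
      simp [deg, Fintype.sum_option]
    rw [Fintype.sum_option, hnone] at key
    simp only [mul_sub, Finset.sum_sub_distrib, ← Finset.sum_mul]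
    have : (G.deg v : ℤ) * B ^ D = G.weight (some v) none * B ^ D
        + (∑ w : W, (G.weight (some v) (some w) : ℤ)) * B ^ D := by
      rw [hdeg]
      ring
    linarith

theorem exists_stabilizes (c : W → ℕ) : ∃ l c', G.Topples c l c' ∧ G.IsStable c' := by
  obtain ⟨h, h0, hh⟩ := G.exists_potential
  suffices H : ∀ (k : ℕ) (c : W → ℕ), ∑ w, (c w : ℤ) * h w ≤ k →
      ∃ l c', G.Topples c l c' ∧ G.IsStable c' from
    H (∑ w, (c w : ℤ) * h w).toNat c (Int.self_le_toNat _)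
  have hstep : ∀ (c : W → ℕ) (v : W), G.deg v ≤ c v →
      ∑ w, (G.topple c v w : ℤ) * h w < ∑ w, (c w : ℤ) * h w := by
    intro c v hv
    have e : ∀ w, (G.topple c v w : ℤ) * h w = (c w : ℤ) * h w
        + (G.weight (some v) (some w) : ℤ) * h w
        - (if w = v then (G.deg v : ℤ) * h v else 0) := by
      intro w
      by_cases hw : w = v
      · subst hw
        simp only [topple, if_true, G.weight_self, Nat.cast_sub hv]
        push_cast
        ring
      · simp only [topple, if_neg hw]
        push_cast
        ring
    rw [Finset.sum_congr rfl fun w _ => e w, Finset.sum_sub_distrib, Finset.sum_add_distrib,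
      Finset.sum_ite_eq' Finset.univ v, if_pos (Finset.mem_univ v)]
    have := hh v
    linarith
  intro k
  induction k with
  | zero =>
    intro c hc
    refine ⟨[], c, Topples.nil c, fun v => ?_⟩
    by_contra hv
    have h1 := hstep c v (not_lt.1 hv)
    have h2 : (0 : ℤ) ≤ ∑ w, (G.topple c v w : ℤ) * h w :=
      Finset.sum_nonneg fun w _ => mul_nonneg (by positivity) (h0 w)
    push_cast at hc
    omega
  | succ k ih =>
    intro c hc
    by_cases hs : G.IsStable c
    · exact ⟨[], c, Topples.nil c, hs⟩
    · simp only [IsStable, not_forall, not_lt] at hs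
      obtain ⟨v, hv⟩ := hs
      have h1 := hstep c v hv
      obtain ⟨l, c', hl, hc'⟩ := ih (G.topple c v) (by push_cast at hc; omega)
      exact ⟨v :: l, c', Topples.cons hv hl, hc'⟩

theorem existsUnique_topplingVector (c : W → ℕ) : ∃! f, G.IsTopplingVector c f := by
  obtain ⟨l, c', hl, hc'⟩ := G.exists_stabilizes c
  refine ⟨fun w => l.count w, ⟨l, c', hl, hc', fun _ => rfl⟩, ?_⟩
  rintro f ⟨l', c'', hl', hc'', hf⟩
  funext w
  rw [hf]
  exact le_antisymm (G.topples_count_le hl' hl hc' w) (G.topples_count_le hl hl' hc'' w)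

/-! ### Avalanche polynomials -/

/-- The toppling vector of the stabilization of `c`. -/
noncomputable def topplingVector (c : W → ℕ) : W → ℕ :=
  (G.existsUnique_topplingVector c).choose

/-- The toppling vector `ν(c, v)` of the stabilization of `c + 1_v`. -/
noncomputable def nu (c : W → ℕ) (v : W) : W → ℕ := G.topplingVector (c + Pi.single v 1)

open Classical in
/-- The finite set of recurrent sandpiles (recurrent sandpiles are stable). -/
noncomputable def recurrents : Finset (W → ℕ) :=
  (Fintype.piFinset fun v => Finset.range (G.deg v)).filter fun c => G.IsRecurrent c

theorem mem_recurrents {c : W → ℕ} : c ∈ G.recurrents ↔ G.IsRecurrent c := by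
  simp only [recurrents, Finset.mem_filter, Fintype.mem_piFinset, Finset.mem_range,
    and_iff_right_iff_imp]
  exact fun h => h.1

/-- The multivariate avalanche polynomial, with rational coefficients: the sum of all
avalanche monomials `x ^ ν(c, v)`, for `c` recurrent and `v` a non-sink vertex. -/
noncomputable def avalanchePolynomial : MvPolynomial W ℚ :=
  ∑ c ∈ G.recurrents, ∑ v : W, ∏ i : W, MvPolynomial.X i ^ G.nu c v i

/-- The size of the principal avalanche of `c` at `v`: the length of the toppling sequence. -/
noncomputable def avalancheSize (c : W → ℕ) (v : W) : ℕ := ∑ i : W, G.nu c v i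

/-- The principal avalanches of size `m`, given by pairs `(c, v)` of a recurrent sandpile and
a non-sink vertex. -/
noncomputable def avalanches (m : ℕ) : Finset ((W → ℕ) × W) :=
  (G.recurrents ×ˢ Finset.univ).filter fun p => G.avalancheSize p.1 p.2 = m

/-- The number `λ_m` of principal avalanches of size `m`. -/
noncomputable def avalancheCount (m : ℕ) : ℕ := (G.avalanches m).card

end SinkGraph

/-- The complete graph `K_{k+1}` with non-sink vertices `v_1, …, v_k` (indexed by `Fin k`). -/
def completeSink (k : ℕ) : SinkGraph (Fin k) where
  weight u v := if u = v then 0 else 1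
  weight_symm u v := by simp only [eq_comm]
  weight_self u := if_pos rfl
  connected := by
    have : (SimpleGraph.fromRel fun u v : Option (Fin k) => 0 < if u = v then 0 else 1) = ⊤ := by
      ext u v
      by_cases h : u = v <;> simp [h]
    rw [this]
    exact SimpleGraph.connected_top

/-- The tuples `(v, J, c₁, c₂)`: a non-sink vertex `v` of `K_{n+1}`, a set `J` of `m - 1`
non-sink vertices different from `v`, a recurrent sandpile `c₁` on `K_m` and a recurrent
sandpile `c₂` on `K_{n-m+1}`. -/
structure AvalancheTuple (n m : ℕ) where
  v : Fin n
  J : Finset (Fin n)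
  notMem : v ∉ J
  card_J : J.card + 1 = m
  c₁ : Fin (m - 1) → ℕ
  c₂ : Fin (n - m) → ℕ
  rec₁ : (completeSink (m - 1)).IsRecurrent c₁
  rec₂ : (completeSink (n - m)).IsRecurrent c₂

namespace AvalancheTuple

variable {n m : ℕ} (t : AvalancheTuple n m)

theorem card_J_eq : t.J.card = m - 1 := by
  have := t.card_J
  omega

theorem card_compl : (insert t.v t.J)ᶜ.card = n - m := by
  rw [Finset.card_compl, Finset.card_insert_of_notMem t.notMem, t.card_J, Fintype.card_fin]

/-- `t = φ(c, v)`: the first entry is `v`; `J` is the set of the vertices other than `v` which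
topple in the principal avalanche of `c` at `v`; `c₁` consists of the values
`c(w) - (n - m + 1)` for `w ∈ J`, and `c₂` of the values `c(w)` for `w ∉ J ∪ {v}`, both listed
in increasing order of the index of `w`. -/
def IsPhi (c : Fin n → ℕ) (v : Fin n) : Prop :=
  t.v = v ∧
  t.J = Finset.univ.filter (fun w => w ≠ v ∧ 0 < (completeSink n).nu c v w) ∧
  (∀ i : Fin (m - 1), c (t.J.orderEmbOfFin t.card_J_eq i) = t.c₁ i + (n - m + 1)) ∧
  ∀ i : Fin (n - m), c ((insert t.v t.J)ᶜ.orderEmbOfFin t.card_compl i) = t.c₂ i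

end AvalancheTuple

/-! ### Toppling sequences on a general sink graph -/

namespace SinkGraph

variable {W : Type*} [Fintype W] [DecidableEq W] (G : SinkGraph W)

/-! On `K_{k+1}` a vertex gains one grain at every toppling except its own. So a set `T` can topple,
each vertex once, as soon as every nonempty `S ⊆ T` contains a vertex with at least `|S| + k - |T|`
grains: this is `Dominates (k - T.card) c T`, a parking-function condition. For `T` the whole vertex
set and `c + 1` in place of `c`, it becomes Dhar's burning criterion `isRecurrent_iff`: firing the
sink makes every vertex topple once and returns `c`.

A principal avalanche starts from `c + 1_v ≤ c + 1`, so each vertex topples at most once and the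
avalanche is determined by its set `T` of toppled vertices. If `T` is nonempty, then `v ∈ T` and `c
v = n - 1`. By `isRecurrent_and_toppled_eq_iff`, the remaining conditions split into one on `J = T \
{v}` and one on the complement of `T`; after a shift on `J` they are the burning criteria of `K_m`
and `K_{n-m+1}`. This gives the bijection.

The count follows from `card_recurrents_mul`, a cyclic argument of Pollak type: each class of
`(ℤ/(k+1))^k` modulo constant vectors contains exactly one recurrent sandpile. The polynomial is a
combination of elementary symmetric ones because its monomials are squarefree and permuting the
vertices preserves all the data. -/

theorem Topples.append {c c' c'' : W → ℕ} {l l' : List W} (h : G.Topples c l c')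
    (h' : G.Topples c' l' c'') : G.Topples c (l ++ l') c'' := by
  induction h with
  | nil c => exact h'
  | cons hv h ih => exact .cons hv (ih h')

theorem topple_add {c : W → ℕ} (d : W → ℕ) {v : W} (hv : G.deg v ≤ c v) :
    G.topple (c + d) v = G.topple c v + d := by
  funext w
  by_cases hw : w = v
  · subst hw
    simp only [topple, if_true, Pi.add_apply]
    omega
  · simp only [topple, if_neg hw, Pi.add_apply]
    omega

theorem Topples.add_right {c c' : W → ℕ} {l : List W} (h : G.Topples c l c') (d : W → ℕ) :
    G.Topples (c + d) l (c' + d) := by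
  induction h with
  | nil c => exact .nil _
  | @cons c c' v l hv h ih =>
    refine .cons (hv.trans (Nat.le_add_right _ _)) ?_
    rw [G.topple_add d hv]
    exact ih

theorem isTopplingVector_topplingVector (c : W → ℕ) :
    G.IsTopplingVector c (G.topplingVector c) :=
  (G.existsUnique_topplingVector c).choose_spec.1

theorem IsTopplingVector.eq_topplingVector {c f : W → ℕ} (h : G.IsTopplingVector c f) :
    f = G.topplingVector c :=
  (G.existsUnique_topplingVector c).unique h (G.isTopplingVector_topplingVector c)

end SinkGraph

/-- Every nonempty subset `S` of `J` has an element `w` with `S.card + d ≤ c w`. -/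
def Dominates {α : Type*} (d : ℕ) (c : α → ℕ) (J : Finset α) : Prop :=
  ∀ S ⊆ J, S.Nonempty → ∃ w ∈ S, S.card + d ≤ c w

theorem dominates_map {α β : Type*} (e : α ↪ β) (d : ℕ) (c : β → ℕ) (J : Finset α) :
    Dominates d c (J.map e) ↔ Dominates d (c ∘ e) J := by
  constructor
  · intro h S hS hne
    obtain ⟨w, hw, hle⟩ := h (S.map e) (Finset.map_subset_map.2 hS) (hne.map)
    obtain ⟨u, hu, rfl⟩ := Finset.mem_map.1 hw
    exact ⟨u, hu, by simpa using hle⟩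
  · intro h S hS hne
    obtain ⟨S', hS', rfl⟩ := Finset.subset_map_iff.1 hS
    obtain ⟨w, hw, hle⟩ := h S' hS' (Finset.map_nonempty.1 hne)
    exact ⟨e w, Finset.mem_map_of_mem e hw, by simpa using hle⟩

/-! ### Toppling on the complete graph and the burning criterion -/

namespace completeSink

open SinkGraph

variable {k : ℕ}

theorem deg_eq (v : Fin k) : (completeSink k).deg v = k := by
  simp [SinkGraph.deg, completeSink, Finset.sum_ite]
  rw [Finset.filter_ne]
  simp

theorem topple_apply (c : Fin k → ℕ) (v w : Fin k) :
    (completeSink k).topple c v w = if w = v then c v - k else c w + 1 := by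
  by_cases h : w = v
  · simp [topple, deg_eq, h]
  · have : ¬ v = w := fun h' => h h'.symm
    simp [topple, h, completeSink, this]

/-- Losing `k` grains is gaining one and losing `k + 1`, so every toppling adds the constant vector
`1`, up to a multiple of `k + 1` at the toppling vertex. -/
theorem Topples.apply_add {c c' : Fin k → ℕ} {l : List (Fin k)}
    (h : (completeSink k).Topples c l c') (w : Fin k) :
    c' w + (k + 1) * l.count w = c w + l.length := by
  induction h with
  | nil c => simp
  | @cons c c' v l hv h ih =>
    rw [topple_apply] at ih
    rw [deg_eq] at hv
    by_cases hw : w = v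
    · subst hw
      simp only [if_true] at ih
      rw [List.count_cons_self, List.length_cons, mul_add]
      omega
    · rw [if_neg hw] at ih
      rw [List.count_cons_of_ne (Ne.symm hw), List.length_cons]
      omega

/-- The witness is the first vertex of `S` to topple. All of `S` topples from that moment on, so at
most `l.length - S.card` grains have reached it before it is unstable. -/
theorem Topples.dominates {c c' : Fin k → ℕ} {l : List (Fin k)}
    (h : (completeSink k).Topples c l c') {S : Finset (Fin k)} (hS : S ⊆ l.toFinset)
    (hne : S.Nonempty) : ∃ w ∈ S, k + S.card ≤ c w + l.length := by
  induction h with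
  | nil c => exact absurd (Finset.subset_empty.1 (by simpa using hS)) hne.ne_empty
  | @cons c c' v l hv h ih =>
    rw [deg_eq] at hv
    by_cases hvS : v ∈ S
    · have := (Finset.card_le_card hS).trans (List.toFinset_card_le _)
      exact ⟨v, hvS, by omega⟩
    · have hS' : S ⊆ l.toFinset := by
        rwa [List.toFinset_cons, Finset.subset_insert_iff_of_notMem hvS] at hS
      obtain ⟨w, hw, hle⟩ := ih hS'
      have hwv : w ≠ v := fun e => hvS (e ▸ hw)
      rw [topple_apply, if_neg hwv] at hle
      refine ⟨w, hw, ?_⟩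
      rw [List.length_cons]
      omega

/-- The witness is the vertex of `S` whose last toppling comes earliest: every other vertex of `S`
still topples afterwards and gives it a grain. -/
theorem Topples.dominates_result {c c' : Fin k → ℕ} {l : List (Fin k)}
    (h : (completeSink k).Topples c l c') {S : Finset (Fin k)} (hS : S ⊆ l.toFinset)
    (hne : S.Nonempty) : ∃ w ∈ S, S.card ≤ c' w + 1 := by
  induction h with
  | nil c => exact absurd (Finset.subset_empty.1 (by simpa using hS)) hne.ne_empty
  | @cons c c' v l hv h ih =>
    by_cases hSl : S ⊆ l.toFinset
    · exact ih hSl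
    · have hSi : S ⊆ insert v l.toFinset := by simpa using hS
      have hvS : v ∈ S := by
        by_contra hvS
        exact hSl ((Finset.subset_insert_iff_of_notMem hvS).1 hSi)
      have hvl : v ∉ l.toFinset := fun hvl => hSl (by rwa [Finset.insert_eq_of_mem hvl] at hSi)
      have h1 := (Finset.card_le_card hSi).trans (Finset.card_insert_le _ _)
      have h2 := List.toFinset_card_le l
      have h3 := Topples.apply_add h v
      rw [List.count_eq_zero_of_not_mem (by simpa using hvl)] at h3
      exact ⟨v, hvS, by omega⟩

/-- A set `T` for which `c` dominates the number `k - T.card` can be toppled, each vertex once. -/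
theorem exists_topples_of_dominates {c : Fin k → ℕ} {T : Finset (Fin k)}
    (h : Dominates (k - T.card) c T) :
    ∃ l c', (completeSink k).Topples c l c' ∧ l.Nodup ∧ l.toFinset = T := by
  have hT : T.card ≤ k := by simpa using Finset.card_le_univ T
  have key : ∀ j ≤ T.card, ∃ l c', (completeSink k).Topples c l c' ∧ l.Nodup ∧
      l.toFinset ⊆ T ∧ l.length = j := by
    intro j
    induction j with
    | zero => exact fun _ => ⟨[], c, .nil c, List.nodup_nil, by simp, rfl⟩
    | succ j ih =>
      intro hj
      obtain ⟨l, c', hl, hnd, hlT, hlen⟩ := ih (by omega)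
      have hc := List.toFinset_card_of_nodup hnd
      have hcard := Finset.card_sdiff_add_card_eq_card hlT
      -- The untoppled part has `T.card - j` elements, so domination yields `w` with at least `k -
      -- j` grains; the `j` topplings so far have made it unstable.
      obtain ⟨w, hw, hle⟩ := h (T \ l.toFinset) Finset.sdiff_subset
        (Finset.card_pos.1 (by omega))
      rw [Finset.mem_sdiff, List.mem_toFinset] at hw
      have h3 := Topples.apply_add hl w
      rw [List.count_eq_zero_of_not_mem hw.2] at h3
      refine ⟨l ++ [w], _, Topples.append _ hl (.cons ?_ (.nil _)), ?_, ?_, by simp [hlen]⟩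
      · rw [deg_eq]
        omega
      · exact List.nodup_append.2 ⟨hnd, by simp, by
          intro a ha b hb e
          rw [List.mem_singleton] at hb
          exact hw.2 (hb ▸ e ▸ ha)⟩
      · intro x hx
        simp only [List.toFinset_append, Finset.mem_union, List.mem_toFinset,
          List.mem_singleton] at hx
        rcases hx with hx | rfl
        · exact hlT (List.mem_toFinset.2 hx)
        · exact hw.1
  obtain ⟨l, c', hl, hnd, hlT, hlen⟩ := key _ le_rfl
  refine ⟨l, c', hl, hnd, Finset.eq_of_subset_of_card_le hlT ?_⟩
  rw [List.toFinset_card_of_nodup hnd, hlen]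

theorem count_eq_ite {l : List (Fin k)} {T : Finset (Fin k)} (hnd : l.Nodup)
    (hT : l.toFinset = T) (w : Fin k) : l.count w = if w ∈ T then 1 else 0 := by
  rw [hnd.count, ← hT]
  simp

/-- When all `k` vertices topple once, each loses `k` grains and receives `k - 1`, which undoes the
`+ 1`. -/
theorem exists_topples_self {c : Fin k → ℕ} (h : Dominates 0 (c + 1) Finset.univ) :
    ∃ l, (completeSink k).Topples (c + 1) l c ∧ l.Nodup := by
  obtain ⟨l, c', hl, hnd, hT⟩ := exists_topples_of_dominates (c := c + 1) (T := Finset.univ)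
    (by simpa using h)
  refine ⟨l, ?_, hnd⟩
  convert hl
  funext w
  have h1 := Topples.apply_add hl w
  have h2 := List.toFinset_card_of_nodup hnd
  rw [count_eq_ite hnd hT, if_pos (Finset.mem_univ w), ← h2, hT, Finset.card_univ,
    Fintype.card_fin, Pi.add_apply, Pi.one_apply] at h1
  omega

/-- The result of a stabilization in which every vertex topples is dominating. -/
theorem dominates_of_stabilizes {a c : Fin k → ℕ} (h : (completeSink k).Stabilizes a c)
    (ha : ∀ w, k ≤ a w) : Dominates 0 (c + 1) Finset.univ := by
  obtain ⟨⟨l, hl⟩, hs⟩ := h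
  have hmem : Finset.univ ⊆ l.toFinset := by
    intro w _
    by_contra hw
    have h1 := Topples.apply_add hl w
    have h2 := hs w
    rw [List.count_eq_zero_of_not_mem (by simpa using hw)] at h1
    rw [deg_eq] at h2
    have := ha w
    omega
  intro S _ hne
  obtain ⟨w, hw, hle⟩ := Topples.dominates_result hl ((Finset.subset_univ S).trans hmem) hne
  exact ⟨w, hw, by simpa using hle⟩

/-- Dhar's burning criterion. Necessity: reach `c` from a sandpile with at least `k` grains
everywhere, which forces every vertex to topple. Sufficiency: `c + 1` topples back to `c`, hence so
does `c + N • 1` for every `N`. -/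
theorem isRecurrent_iff {c : Fin k → ℕ} :
    (completeSink k).IsRecurrent c ↔ (∀ w, c w < k) ∧ Dominates 0 (c + 1) Finset.univ := by
  have hst : (completeSink k).IsStable c ↔ ∀ w, c w < k := by
    simp only [SinkGraph.IsStable, deg_eq]
  constructor
  · rintro ⟨hs, h⟩
    obtain ⟨b, hb⟩ := h (fun _ => k)
    exact ⟨hst.1 hs, dominates_of_stabilizes hb fun w => Nat.le_add_right _ _⟩
  · rintro ⟨hs, h⟩
    refine ⟨hst.2 hs, fun a => ?_⟩
    obtain ⟨l, hl, -⟩ := exists_topples_self h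
    have hN : ∀ N : ℕ, ∃ l, (completeSink k).Topples (c + N • (1 : Fin k → ℕ)) l c := by
      intro N
      induction N with
      | zero => exact ⟨[], by simpa using Topples.nil c⟩
      | succ N ih =>
        obtain ⟨l', hl'⟩ := ih
        refine ⟨l ++ l', Topples.append _ ?_ hl'⟩
        have := Topples.add_right _ hl (N • (1 : Fin k → ℕ))
        rwa [add_assoc, ← succ_nsmul'] at this
    -- `N` is the total of `a`, which bounds each `a w`; the subtraction defining `b` is then not
    -- truncated.
    obtain ⟨l', hl'⟩ := hN (∑ w, a w)
    refine ⟨fun w => c w + ∑ w, a w - a w, ⟨l', ?_⟩, hst.2 hs⟩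
    convert hl' using 1
    funext w
    have := Finset.single_le_sum (f := a) (fun _ _ => Nat.zero_le _) (Finset.mem_univ w)
    simp only [Pi.add_apply, Pi.smul_apply, Pi.one_apply, smul_eq_mul, mul_one]
    omega

/-! ### The number of recurrent sandpiles -/

/-- Suppose `t > 0`. Domination for `c` on the vertices with `c w + t < k` leaves at least `t`
vertices in `S`. On `S`, reduction modulo `k + 1` gives `c' w ≤ t - 2` (the residue `k` is excluded
by stability), contradicting domination for `c'` on `S`. -/
theorem shift_eq_zero_of_isRecurrent {c c' : Fin k → ℕ} (h : (completeSink k).IsRecurrent c)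
    (h' : (completeSink k).IsRecurrent c') {t : ℕ} (ht : t ≤ k)
    (hmod : ∀ w, c' w ≡ c w + t [MOD k + 1]) : t = 0 ∨ k = 0 := by
  by_contra! hcon
  obtain ⟨ht0, -⟩ := hcon
  rw [isRecurrent_iff] at h h'
  have hlt : ∀ w, c' w = (c w + t) % (k + 1) := fun w => by
    rw [← hmod w, Nat.mod_eq_of_lt ((h'.1 w).trans (Nat.lt_succ_self k))]
  let S := Finset.univ.filter fun w => k ≤ c w + t
  let T := Finset.univ.filter fun w => ¬ k ≤ c w + t
  have hST : S.card + T.card = k := by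
    rw [Finset.card_filter_add_card_filter_not, Finset.card_univ, Fintype.card_fin]
  have hS : t ≤ S.card := by
    by_cases hT : T.Nonempty
    · obtain ⟨w, hw, hle⟩ := h.2 T (Finset.subset_univ _) hT
      have := (Finset.mem_filter.1 hw).2
      simp only [Pi.add_apply, Pi.one_apply] at hle
      omega
    · have : T.card = 0 := by simpa [Finset.not_nonempty_iff_eq_empty] using hT
      omega
  obtain ⟨w, hw, hle⟩ := h'.2 S (Finset.subset_univ _) (Finset.card_pos.1 (by omega))
  have h1 := (Finset.mem_filter.1 hw).2
  have h2 := hlt w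
  have h3 := h'.1 w
  have h4 := h.1 w
  simp only [Pi.add_apply, Pi.one_apply] at hle
  rcases h1.eq_or_lt with h1 | h1
  · rw [Nat.mod_eq_of_lt (by omega)] at h2
    omega
  · rw [Nat.mod_eq_sub_mod (by omega), Nat.mod_eq_of_lt (by omega)] at h2
    omega

/-- Every vector over `ℤ/(k+1)` is uniquely a recurrent sandpile plus a constant. Existence comes
from stabilizing a lift, since toppling modulo `k + 1` only adds constants. -/
theorem card_recurrents_mul (k : ℕ) :
    (completeSink k).recurrents.card * (k + 1) = (k + 1) ^ k := by
  let F : {c // c ∈ (completeSink k).recurrents} × ZMod (k + 1) → (Fin k → ZMod (k + 1)) :=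
    fun p w => (p.1.1 w : ZMod (k + 1)) + p.2
  have hF : Function.Bijective F := by
    constructor
    · rintro ⟨⟨c, hc⟩, t⟩ ⟨⟨c', hc'⟩, t'⟩ h
      rw [mem_recurrents] at hc hc'
      have hw : ∀ w, (c' w : ZMod (k + 1)) = c w + (t - t') := fun w => by
        have : (c w : ZMod (k + 1)) + t = c' w + t' := congrFun h w
        linear_combination -this
      have h0 : (t - t').val = 0 ∨ k = 0 := by
        refine shift_eq_zero_of_isRecurrent hc hc' (Nat.lt_succ_iff.1 (ZMod.val_lt _)) fun w => ?_
        rw [← ZMod.natCast_eq_natCast_iff]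
        push_cast
        rw [ZMod.natCast_zmod_val, hw]
      have htt : t = t' := by
        rcases h0 with h0 | rfl
        · exact sub_eq_zero.1 ((ZMod.val_eq_zero _).1 h0)
        · exact Subsingleton.elim (α := Fin 1) _ _
      subst htt
      have hcc : c = c' := by
        funext w
        have := hw w
        rw [sub_self, add_zero, ZMod.natCast_eq_natCast_iff] at this
        exact (this.eq_of_lt_of_lt ((isRecurrent_iff.1 hc').1 w |>.trans (Nat.lt_succ_self k))
          ((isRecurrent_iff.1 hc).1 w |>.trans (Nat.lt_succ_self k))).symm
      subst hcc
      rfl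
    · intro f
      -- The extra `k` makes every vertex unstable, so the stabilization is recurrent; the constant
      -- shift below removes it again.
      let a : Fin k → ℕ := fun w => k + (f w).val
      obtain ⟨l, c, hl, hs⟩ := (completeSink k).exists_stabilizes a
      have hrec : (completeSink k).IsRecurrent c := isRecurrent_iff.2
        ⟨fun w => by simpa [deg_eq] using hs w,
          dominates_of_stabilizes ⟨⟨l, hl⟩, hs⟩ fun w => Nat.le_add_right _ _⟩
      refine ⟨⟨⟨c, (mem_recurrents _).2 hrec⟩, -((k : ZMod (k + 1)) + l.length)⟩, ?_⟩
      funext w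
      have h1 := congrArg (Nat.cast (R := ZMod (k + 1))) (Topples.apply_add hl w)
      have h2 : ((k + 1 : ℕ) : ZMod (k + 1)) = 0 := ZMod.natCast_self _
      push_cast [a] at h1 h2
      rw [h2, ZMod.natCast_zmod_val] at h1
      simp only [F]
      linear_combination h1
  have := Fintype.card_of_bijective hF
  simpa [Fintype.card_prod] using this

/-! ### Principal avalanches -/

/-- The set of vertices toppling in the principal avalanche of `c` at `v`. -/
noncomputable def toppled (c : Fin k → ℕ) (v : Fin k) : Finset (Fin k) :=
  Finset.univ.filter fun w => 0 < (completeSink k).nu c v w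

theorem exists_topples_toppled {c : Fin k → ℕ} (hc : (completeSink k).IsRecurrent c)
    (v : Fin k) : ∃ l c', (completeSink k).Topples (c + Pi.single v 1) l c' ∧
      (completeSink k).IsStable c' ∧ l.Nodup ∧ l.toFinset = toppled c v ∧
      ∀ w, (completeSink k).nu c v w = l.count w := by
  obtain ⟨l, c', hl, hs, hf⟩ :=
    (completeSink k).isTopplingVector_topplingVector (c + Pi.single v 1)
  change ∀ w, (completeSink k).nu c v w = l.count w at hf
  obtain ⟨l', hl', hnd⟩ := exists_topples_self (isRecurrent_iff.1 hc).2
  refine ⟨l, c', hl, hs, ?_, ?_, hf⟩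
  · rw [List.nodup_iff_count_le_one]
    intro w
    -- Topping `c + 1_v` up to `c + 1` keeps the sequence legal, so its counts are bounded by those
    -- of the burning sequence, in which no vertex repeats.
    have h1 := Topples.add_right _ hl ((1 : Fin k → ℕ) - Pi.single v 1)
    rw [add_assoc, add_tsub_cancel_of_le] at h1
    · exact ((completeSink k).topples_count_le h1 hl' hc.1 w).trans
        (List.nodup_iff_count_le_one.1 hnd w)
    · intro w
      by_cases h : w = v
      · subst h; simp
      · simp [h]
  · ext w
    simp [toppled, hf, List.count_pos_iff]

theorem nu_eq_ite {c : Fin k → ℕ} (hc : (completeSink k).IsRecurrent c) (v w : Fin k) :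
    (completeSink k).nu c v w = if w ∈ toppled c v then 1 else 0 := by
  obtain ⟨l, c', -, -, hnd, hT, hf⟩ := exists_topples_toppled hc v
  rw [hf, count_eq_ite hnd hT]

theorem avalancheSize_eq {c : Fin k → ℕ} (hc : (completeSink k).IsRecurrent c) (v : Fin k) :
    (completeSink k).avalancheSize c v = (toppled c v).card := by
  simp [avalancheSize, nu_eq_ite hc]

theorem dominates_toppled {c : Fin k → ℕ} (hc : (completeSink k).IsRecurrent c) (v : Fin k) :
    Dominates (k - (toppled c v).card) (c + Pi.single v 1) (toppled c v) := by
  obtain ⟨l, c', hl, -, hnd, hT, -⟩ := exists_topples_toppled hc v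
  intro S hS hne
  obtain ⟨w, hw, hle⟩ := Topples.dominates hl (hT ▸ hS) hne
  have := List.toFinset_card_of_nodup hnd
  rw [hT] at this
  have hT : (toppled c v).card ≤ k := by simpa using Finset.card_le_univ (toppled c v)
  exact ⟨w, hw, by omega⟩

/-- Domination on the full toppled set yields a vertex with `k` grains in `c + 1_v`; as `c` is
stable, it can only be `v`. -/
theorem mem_toppled {c : Fin k → ℕ} (hc : (completeSink k).IsRecurrent c) {v : Fin k}
    (hne : (toppled c v).Nonempty) : v ∈ toppled c v ∧ c v + 1 = k := by
  obtain ⟨w, hw, hle⟩ := dominates_toppled hc v _ subset_rfl hne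
  have hT : (toppled c v).card ≤ k := by simpa using Finset.card_le_univ (toppled c v)
  have h1 := (isRecurrent_iff.1 hc).1 w
  have hwv : w = v := by
    by_contra h
    simp [h] at hle
    omega
  subst hwv
  simp only [Pi.add_apply, Pi.single_eq_same] at hle
  exact ⟨hw, by omega⟩

theorem apply_lt_of_notMem_toppled {c : Fin k → ℕ} (hc : (completeSink k).IsRecurrent c)
    {v w : Fin k} (hw : w ∉ toppled c v) : c w + (toppled c v).card < k := by
  obtain ⟨l, c', hl, hs, hnd, hT, hf⟩ := exists_topples_toppled hc v
  have h1 := Topples.apply_add hl w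
  rw [count_eq_ite hnd hT, if_neg hw, ← List.toFinset_card_of_nodup hnd, hT] at h1
  have h2 := hs w
  rw [deg_eq] at h2
  simp only [Pi.add_apply] at h1
  omega

/-- Domination lets `T` topple once. The result is stable: a vertex of `T` ends with at most `c w +
1 + T.card - (k + 1) < k` grains, and `hout` handles the others. Uniqueness of the toppling vector
concludes. -/
theorem toppled_eq {c : Fin k → ℕ} (hc : (completeSink k).IsRecurrent c) {v : Fin k}
    {T : Finset (Fin k)} (hv : v ∈ T)
    (hT : Dominates (k - T.card) (c + Pi.single v 1) T) (hout : ∀ w ∉ T, c w + T.card < k) :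
    toppled c v = T := by
  obtain ⟨l, c', hl, hnd, hlT⟩ := exists_topples_of_dominates hT
  have hcard : T.card ≤ k := by simpa using Finset.card_le_univ T
  have hs : (completeSink k).IsStable c' := by
    intro w
    have h1 := Topples.apply_add hl w
    have h2 := (isRecurrent_iff.1 hc).1 w
    rw [count_eq_ite hnd hlT, ← List.toFinset_card_of_nodup hnd, hlT, Pi.add_apply] at h1
    rw [deg_eq]
    by_cases hw : w ∈ T
    · rw [if_pos hw] at h1
      have : (Pi.single v 1 : Fin k → ℕ) w ≤ 1 := by
        rw [Pi.single_apply]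
        split <;> omega
      omega
    · rw [if_neg hw, Pi.single_eq_of_ne (by rintro rfl; exact hw hv)] at h1
      have := hout w hw
      omega
  have hf := IsTopplingVector.eq_topplingVector _
    (⟨l, c', hl, hs, fun _ => rfl⟩ :
      (completeSink k).IsTopplingVector (c + Pi.single v 1) fun w => l.count w)
  change _ = (completeSink k).nu c v at hf
  rw [toppled, ← hf, ← hlT]
  ext w
  simp [List.count_pos_iff]

end completeSink

/-! ### Splitting a principal avalanche and the bijection -/

namespace completeSink

open SinkGraph

variable {n m : ℕ}

theorem mem_avalanches {p : (Fin n → ℕ) × Fin n} :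
    p ∈ (completeSink n).avalanches m ↔
      (completeSink n).IsRecurrent p.1 ∧ (toppled p.1 p.2).card = m := by
  rw [avalanches, Finset.mem_filter, Finset.mem_product, mem_recurrents]
  constructor
  · rintro ⟨⟨h, -⟩, h'⟩
    exact ⟨h, avalancheSize_eq h p.2 ▸ h'⟩
  · rintro ⟨h, h'⟩
    exact ⟨⟨h, Finset.mem_univ _⟩, (avalancheSize_eq h p.2).trans h'⟩

/-- The constraints on `v`, on `J` and on the remaining vertices become independent, so the two
restrictions of `c` can be prescribed separately. -/
theorem isRecurrent_and_toppled_eq_iff {c : Fin n → ℕ} {v : Fin n} {J : Finset (Fin n)}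
    (hv : v ∉ J) (hJ : J.card + 1 = m) :
    (completeSink n).IsRecurrent c ∧ toppled c v = insert v J ↔
      c v + 1 = n ∧ ((∀ w ∈ J, c w < n) ∧ Dominates (n - m) c J) ∧
      (∀ w ∈ (insert v J)ᶜ, c w < n - m) ∧ Dominates 0 (c + 1) (insert v J)ᶜ := by
  have hcard : (insert v J).card = m := by rw [Finset.card_insert_of_notMem hv, hJ]
  have hmn : m ≤ n := by simpa [hcard] using Finset.card_le_univ (insert v J)
  constructor
  · rintro ⟨hc, hT⟩
    have hc' := isRecurrent_iff.1 hc
    refine ⟨(mem_toppled hc (hT ▸ Finset.insert_nonempty v J)).2, ⟨fun w _ => hc'.1 w, ?_⟩,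
      ?_, fun S _ hne => hc'.2 S (Finset.subset_univ S) hne⟩
    · intro S hS hne
      have hd := dominates_toppled hc v
      rw [hT, hcard] at hd
      obtain ⟨w, hw, hle⟩ := hd S (hS.trans (Finset.subset_insert v J)) hne
      have hwv : w ≠ v := by
        rintro rfl
        exact hv (hS hw)
      exact ⟨w, hw, by simpa [hwv] using hle⟩
    · intro w hw
      rw [Finset.mem_compl, ← hT] at hw
      have := apply_lt_of_notMem_toppled hc hw
      rw [hT, hcard] at this
      omega
  · rintro ⟨h1, ⟨h2, h3⟩, h4, h5⟩
    have hc : (completeSink n).IsRecurrent c := by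
      rw [isRecurrent_iff]
      constructor
      · intro w
        by_cases hw : w ∈ insert v J
        · rcases Finset.mem_insert.1 hw with rfl | hw
          · omega
          · exact h2 w hw
        · have := h4 w (Finset.mem_compl.2 hw)
          omega
      · intro S _ hne
        by_cases hvS : v ∈ S
        · refine ⟨v, hvS, ?_⟩
          have : S.card ≤ n := by simpa using Finset.card_le_univ S
          simp only [Pi.add_apply, Pi.one_apply]
          omega
        -- If `S` meets `J`, domination on `S ∩ J` has a surplus of `n - m`, enough to pay for all
        -- of `S \ J`, which lies among the `n - m` untoppled vertices.
        · by_cases hSJ : (S ∩ J).Nonempty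
          · obtain ⟨w, hw, hle⟩ := h3 _ Finset.inter_subset_right hSJ
            refine ⟨w, Finset.mem_of_mem_inter_left hw, ?_⟩
            have e1 : (S \ J).card ≤ n - m := by
              have : S \ J ⊆ (insert v J)ᶜ := by
                intro x hx
                rw [Finset.mem_sdiff] at hx
                rw [Finset.mem_compl, Finset.mem_insert, not_or]
                exact ⟨by rintro rfl; exact hvS hx.1, hx.2⟩
              have := Finset.card_le_card this
              rwa [Finset.card_compl, hcard, Fintype.card_fin] at this
            have e2 := Finset.card_inter_add_card_sdiff S J
            simp only [Pi.add_apply, Pi.one_apply]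
            omega
          · refine h5 S (fun x hx => ?_) hne
            rw [Finset.mem_compl, Finset.mem_insert, not_or]
            exact ⟨by rintro rfl; exact hvS hx,
              fun hxJ => hSJ ⟨x, Finset.mem_inter.2 ⟨hx, hxJ⟩⟩⟩
    refine ⟨hc, toppled_eq hc (Finset.mem_insert_self v J) ?_ ?_⟩
    · rw [hcard]
      intro S hS hne
      by_cases hvS : v ∈ S
      · refine ⟨v, hvS, ?_⟩
        have := hcard ▸ Finset.card_le_card hS
        simp only [Pi.add_apply, Pi.single_eq_same]
        omega
      · obtain ⟨w, hw, hle⟩ := h3 S ((Finset.subset_insert_iff_of_notMem hvS).1 hS) hne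
        exact ⟨w, hw, hle.trans (Nat.le_add_right _ _)⟩
    · intro w hw
      have := h4 w (Finset.mem_compl.2 hw)
      rw [hcard]
      omega

/-- Recurrence of the pull-back to `Fin k` of a sandpile shifted by `d`. -/
theorem isRecurrent_pullback_iff {k : ℕ} {c : Fin n → ℕ} {J : Finset (Fin n)} (h : J.card = k)
    {c₁ : Fin k → ℕ} {d : ℕ} (hc : ∀ i, c (J.orderEmbOfFin h i) = c₁ i + d) :
    (completeSink k).IsRecurrent c₁ ↔ (∀ w ∈ J, c w < k + d) ∧ Dominates d (c + 1) J := by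
  have hJ : J = Finset.univ.map (J.orderEmbOfFin h).toEmbedding :=
    (Finset.map_orderEmbOfFin_univ J h).symm
  have hcomp : (c + 1) ∘ (J.orderEmbOfFin h) = fun i => c₁ i + 1 + d := by
    funext i
    simp only [Function.comp_apply, Pi.add_apply, Pi.one_apply, hc]
    omega
  have hd : Dominates d (c + 1) J ↔ Dominates 0 (c₁ + 1) Finset.univ := by
    have := dominates_map (J.orderEmbOfFin h).toEmbedding d (c + 1) Finset.univ
    rw [← hJ] at this
    refine this.trans ?_
    change Dominates d ((c + 1) ∘ (J.orderEmbOfFin h)) Finset.univ ↔ _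
    rw [hcomp]
    simp [Dominates]
  rw [isRecurrent_iff, hd]
  refine and_congr_left fun _ => ?_
  constructor
  · intro hlt w hw
    obtain ⟨i, rfl⟩ : w ∈ Set.range (J.orderEmbOfFin h) := by simpa using hw
    have := hlt i
    rw [hc]
    omega
  · intro hlt i
    have := hlt _ (J.orderEmbOfFin_mem h i)
    rw [hc] at this
    omega

theorem filter_ne_and_nu_pos (c : Fin n → ℕ) (v : Fin n) :
    Finset.univ.filter (fun w => w ≠ v ∧ 0 < (completeSink n).nu c v w) =
      (toppled c v).erase v := by
  ext w
  simp [toppled]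

/-- The burning criterion concerns `c + 1`, the avalanche condition on `J` concerns `c`. This is why
`c₁` is shifted by `n - m + 1` and not by `n - m`. -/
theorem dominates_succ_add_one {α : Type*} {d : ℕ} {c : α → ℕ} {J : Finset α} :
    Dominates (d + 1) (c + 1) J ↔ Dominates d c J := by
  simp only [Dominates, Pi.add_apply, Pi.one_apply, ← add_assoc, Nat.add_le_add_iff_right]

/-- A sandpile that agrees with the tuple `t` and is maximal at `t.v` has the principal avalanche
described by `t`. -/
theorem isRecurrent_and_toppled_eq (t : AvalancheTuple n m) {c : Fin n → ℕ} (hv : c t.v + 1 = n)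
    (h₁ : ∀ i, c (t.J.orderEmbOfFin t.card_J_eq i) = t.c₁ i + (n - m + 1))
    (h₂ : ∀ i, c ((insert t.v t.J)ᶜ.orderEmbOfFin t.card_compl i) = t.c₂ i) :
    (completeSink n).IsRecurrent c ∧ toppled c t.v = insert t.v t.J := by
  have hcard : (insert t.v t.J).card = m := by
    rw [Finset.card_insert_of_notMem t.notMem, t.card_J]
  have hmn : m ≤ n := by simpa [hcard] using Finset.card_le_univ (insert t.v t.J)
  have hm := t.card_J
  have r₁ := (isRecurrent_pullback_iff t.card_J_eq h₁).1 t.rec₁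
  have r₂ := (isRecurrent_pullback_iff (d := 0) t.card_compl h₂).1 t.rec₂
  rw [dominates_succ_add_one] at r₁
  refine (isRecurrent_and_toppled_eq_iff t.notMem t.card_J).2 ⟨hv, ⟨fun w hw => ?_, r₁.2⟩, r₂⟩
  have := r₁.1 w hw
  omega

theorem exists_isPhi {c : Fin n → ℕ} {v : Fin n} (hc : (completeSink n).IsRecurrent c)
    (hm : (toppled c v).card = m) (hm1 : 1 ≤ m) :
    ∃ t : AvalancheTuple n m, t.IsPhi c v := by
  have hvT := mem_toppled hc (Finset.card_pos.1 (by omega : 0 < (toppled c v).card))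
  have hJ : ((toppled c v).erase v).card + 1 = m := by
    rw [Finset.card_erase_add_one hvT.1, hm]
  have hmn : m ≤ n := by simpa [hm] using Finset.card_le_univ (toppled c v)
  have hins : insert v ((toppled c v).erase v) = toppled c v := Finset.insert_erase hvT.1
  obtain ⟨-, ⟨h2, h3⟩, h45⟩ := (isRecurrent_and_toppled_eq_iff
    (Finset.notMem_erase v (toppled c v)) hJ).1 ⟨hc, hins.symm⟩
  have hJ' : ((toppled c v).erase v).card = m - 1 := by omega
  have hK' : (insert v ((toppled c v).erase v))ᶜ.card = n - m := by
    rw [hins, Finset.card_compl, hm, Fintype.card_fin]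
  have hsub : ∀ i, c (((toppled c v).erase v).orderEmbOfFin hJ' i) =
      (c (((toppled c v).erase v).orderEmbOfFin hJ' i) - (n - m + 1)) + (n - m + 1) := by
    intro i
    -- Domination on singletons gives at least `n - m + 1` grains on `J`, so the subtraction is
    -- exact.
    obtain ⟨w, hw, hle⟩ := h3 {((toppled c v).erase v).orderEmbOfFin hJ' i}
      (Finset.singleton_subset_iff.2 (Finset.orderEmbOfFin_mem _ _ _))
      (Finset.singleton_nonempty _)
    rw [Finset.mem_singleton] at hw
    rw [Finset.card_singleton, hw] at hle
    omega
  exact ⟨{ v := v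
           J := (toppled c v).erase v
           notMem := Finset.notMem_erase v _
           card_J := hJ
           c₁ := _
           c₂ := _
           rec₁ := (isRecurrent_pullback_iff hJ' hsub).2
            ⟨fun w hw => by have := h2 w hw; omega, dominates_succ_add_one.2 h3⟩
           rec₂ := (isRecurrent_pullback_iff (d := 0) hK' fun _ => rfl).2 h45 },
    rfl, (filter_ne_and_nu_pos c v).symm, hsub, fun _ => rfl⟩

theorem exists_sandpile_of_tuple (t : AvalancheTuple n m) :
    ∃ c, (c, t.v) ∈ (completeSink n).avalanches m ∧ t.IsPhi c t.v := by
  -- The value `n - 1` at `t.v` is forced by `mem_toppled`; the final default `0` is never reached.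
  let c : Fin n → ℕ := fun w =>
    if w = t.v then n - 1
    else if h : w ∈ t.J then t.c₁ ((t.J.orderIsoOfFin t.card_J_eq).symm ⟨w, h⟩) + (n - m + 1)
    else if h : w ∈ (insert t.v t.J)ᶜ then
      t.c₂ (((insert t.v t.J)ᶜ.orderIsoOfFin t.card_compl).symm ⟨w, h⟩)
    else 0
  have hn : 0 < n := t.v.pos
  have hv : c t.v + 1 = n := by
    simp only [c, if_true]
    omega
  have h₁ : ∀ i, c (t.J.orderEmbOfFin t.card_J_eq i) = t.c₁ i + (n - m + 1) := by
    intro i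
    have hmem := t.J.orderEmbOfFin_mem t.card_J_eq i
    have hne : t.J.orderEmbOfFin t.card_J_eq i ≠ t.v := fun e => t.notMem (e ▸ hmem)
    have : (t.J.orderIsoOfFin t.card_J_eq).symm ⟨_, hmem⟩ = i := by
      rw [OrderIso.symm_apply_eq]
      rfl
    simp only [c, if_neg hne, dif_pos hmem, this]
  have h₂ : ∀ i, c ((insert t.v t.J)ᶜ.orderEmbOfFin t.card_compl i) = t.c₂ i := by
    intro i
    have hmem := (insert t.v t.J)ᶜ.orderEmbOfFin_mem t.card_compl i
    have hne := hmem
    rw [Finset.mem_compl, Finset.mem_insert, not_or] at hne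
    have : ((insert t.v t.J)ᶜ.orderIsoOfFin t.card_compl).symm ⟨_, hmem⟩ = i := by
      rw [OrderIso.symm_apply_eq]
      rfl
    simp only [c, if_neg hne.1, dif_neg hne.2, dif_pos hmem, this]
  obtain ⟨hc, hT⟩ := isRecurrent_and_toppled_eq t hv h₁ h₂
  refine ⟨c, mem_avalanches.2 ⟨hc, ?_⟩, rfl, ?_, h₁, h₂⟩
  · change (toppled c t.v).card = m
    rw [hT, Finset.card_insert_of_notMem t.notMem, t.card_J]
  · rw [filter_ne_and_nu_pos, hT, Finset.erase_insert t.notMem]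

theorem isPhi_unique_tuple {t t' : AvalancheTuple n m} {c : Fin n → ℕ} {v : Fin n}
    (h : t.IsPhi c v) (h' : t'.IsPhi c v) : t = t' := by
  obtain ⟨v₀, J, _, _, c₁, c₂, _, _⟩ := t
  obtain ⟨v₀', J', _, _, c₁', c₂', _, _⟩ := t'
  obtain ⟨hv, hJ, h₁, h₂⟩ := h
  obtain ⟨hv', hJ', h₁', h₂'⟩ := h'
  obtain rfl : v₀ = v₀' := hv.trans hv'.symm
  obtain rfl : J = J' := hJ.trans hJ'.symm
  obtain rfl : c₁ = c₁' := funext fun i => Nat.add_right_cancel ((h₁ i).symm.trans (h₁' i))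
  obtain rfl : c₂ = c₂' := funext fun i => (h₂ i).symm.trans (h₂' i)
  rfl

/-- The tuple records every value of the sandpile except the one at `v`, hence the hypothesis `hv`.
For a nonempty avalanche that value is always `n - 1`. -/
theorem isPhi_unique_sandpile {t : AvalancheTuple n m} {c c' : Fin n → ℕ} {v v' : Fin n}
    (h : t.IsPhi c v) (h' : t.IsPhi c' v') (hv : c v = c' v') : (c, v) = (c', v') := by
  obtain ⟨rfl, -, h₁, h₂⟩ := h
  obtain ⟨rfl, -, h₁', h₂'⟩ := h'
  refine Prod.ext (funext fun w => ?_) rfl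
  dsimp only
  by_cases hw : w = t.v
  · rw [hw, hv]
  · by_cases hJ : w ∈ t.J
    · obtain ⟨i, rfl⟩ : w ∈ Set.range (t.J.orderEmbOfFin t.card_J_eq) := by simpa using hJ
      rw [h₁, h₁']
    · obtain ⟨i, rfl⟩ : w ∈ Set.range ((insert t.v t.J)ᶜ.orderEmbOfFin t.card_compl) := by
        rw [Finset.range_orderEmbOfFin, Finset.mem_coe, Finset.mem_compl, Finset.mem_insert,
          not_or]
        exact ⟨hw, hJ⟩
      rw [h₂, h₂']

theorem exists_equiv_isPhi (hm : 1 ≤ m) :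
    ∃ φ : {p : (Fin n → ℕ) × Fin n // p ∈ (completeSink n).avalanches m} ≃
      AvalancheTuple n m, ∀ p, (φ p).IsPhi p.1.1 p.1.2 := by
  have hex : ∀ p : {p : (Fin n → ℕ) × Fin n // p ∈ (completeSink n).avalanches m},
      ∃ t : AvalancheTuple n m, t.IsPhi p.1.1 p.1.2 := fun p =>
    exists_isPhi (mem_avalanches.1 p.2).1 (mem_avalanches.1 p.2).2 hm
  choose φ hφ using hex
  have hval : ∀ p : {p : (Fin n → ℕ) × Fin n // p ∈ (completeSink n).avalanches m},
      p.1.1 p.1.2 + 1 = n := fun p =>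
    (mem_toppled (mem_avalanches.1 p.2).1
      (Finset.card_pos.1 (hm.trans_eq (mem_avalanches.1 p.2).2.symm))).2
  refine ⟨Equiv.ofBijective φ ⟨fun p q hpq => ?_, fun t => ?_⟩, hφ⟩
  · have hp := hφ p
    have hq := hφ q
    rw [← hpq] at hq
    exact Subtype.ext (isPhi_unique_sandpile hp hq
      (Nat.add_right_cancel ((hval p).trans (hval q).symm)))
  · obtain ⟨c, hc, ht⟩ := exists_sandpile_of_tuple t
    exact ⟨⟨(c, t.v), hc⟩, isPhi_unique_tuple (hφ ⟨(c, t.v), hc⟩) ht⟩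

/-! ### Counting avalanches -/

/-- A tuple is a vertex, a set avoiding it and two recurrent sandpiles. -/
def tupleEquiv (hm : 1 ≤ m) : AvalancheTuple n m ≃
    (Σ v : Fin n, {J // J ∈ Finset.powersetCard (m - 1) (Finset.univ.erase v)}) ×
      {c // c ∈ (completeSink (m - 1)).recurrents} ×
      {c // c ∈ (completeSink (n - m)).recurrents} where
  toFun t := ⟨⟨t.v, t.J, by
    rw [Finset.mem_powersetCard, Finset.subset_erase]
    exact ⟨⟨Finset.subset_univ _, t.notMem⟩, t.card_J_eq⟩⟩,
    ⟨t.c₁, (mem_recurrents _).2 t.rec₁⟩, ⟨t.c₂, (mem_recurrents _).2 t.rec₂⟩⟩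
  invFun x :=
    { v := x.1.1
      J := x.1.2.1
      notMem := (Finset.subset_erase.1 (Finset.mem_powersetCard.1 x.1.2.2).1).2
      card_J := by
        rw [(Finset.mem_powersetCard.1 x.1.2.2).2]
        omega
      c₁ := x.2.1.1
      c₂ := x.2.2.1
      rec₁ := (mem_recurrents _).1 x.2.1.2
      rec₂ := (mem_recurrents _).1 x.2.2.2 }
  left_inv _ := rfl
  right_inv _ := rfl

theorem avalancheCount_eq (hm : 1 ≤ m) :
    (completeSink n).avalancheCount m = n * (n - 1).choose (m - 1) *
      ((completeSink (m - 1)).recurrents.card * (completeSink (n - m)).recurrents.card) := by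
  obtain ⟨φ, -⟩ := exists_equiv_isPhi (n := n) hm
  have := Nat.card_congr (φ.trans (tupleEquiv hm))
  rw [Nat.card_eq_fintype_card, Nat.card_eq_fintype_card] at this
  simpa only [avalancheCount, Fintype.card_prod, Fintype.card_sigma, Fintype.card_coe,
    Finset.card_powersetCard, Finset.card_erase_of_mem (Finset.mem_univ _), Finset.card_univ,
    Fintype.card_fin, Finset.sum_const, smul_eq_mul] using this

theorem avalancheCount_eq_rat (hm : 1 ≤ m) (hmn : m ≤ n) :
    ((completeSink n).avalancheCount m : ℚ) =
      (n.choose m : ℚ) * (m : ℚ) ^ (m - 1) *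
        ((n : ℚ) - (m : ℚ) + 1) ^ ((n : ℤ) - (m : ℤ) - 1) := by
  obtain ⟨m, rfl⟩ := Nat.exists_eq_add_of_le' hm
  obtain ⟨d, rfl⟩ := Nat.exists_eq_add_of_le' hmn
  have e1 := card_recurrents_mul m
  have e2 := card_recurrents_mul d
  have e3 := Nat.add_one_mul_choose_eq (d + m) m
  have hne : (d + 1 : ℚ) ≠ 0 := by positivity
  -- Here `d` is `n - m`. For `d = 0` the exponent is `-1` and the base is `1`, so an integer power
  -- is needed.
  have e4 : ((d + 1 : ℚ)) ^ ((d : ℤ) - 1) = (completeSink d).recurrents.card := by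
    rw [zpow_sub_one₀ hne, zpow_natCast, ← div_eq_mul_inv, div_eq_iff hne]
    exact_mod_cast e2.symm
  rw [avalancheCount_eq hm]
  have e5 : ((d + (m + 1) : ℕ) : ℚ) - ((m + 1 : ℕ) : ℚ) + 1 = d + 1 := by push_cast; ring
  have e6 : ((d + (m + 1) : ℕ) : ℤ) - ((m + 1 : ℕ) : ℤ) - 1 = (d : ℤ) - 1 := by push_cast; ring
  rw [e5, e6, e4, Nat.add_sub_cancel, Nat.add_sub_cancel]
  have : (d + (m + 1)) * (d + (m + 1) - 1).choose m *
      ((completeSink m).recurrents.card * (completeSink d).recurrents.card) =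
      (d + (m + 1)).choose (m + 1) * (m + 1) ^ m * (completeSink d).recurrents.card := by
    -- The absorption identity `e3` produces a factor `m + 1`, which `e1` combines with the number
    -- of recurrent sandpiles on `K_{m+1}` into `(m + 1) ^ m`.
    rw [← e1, show d + (m + 1) - 1 = d + m by omega, ← add_assoc, e3]
    ring
  exact_mod_cast this

end completeSink

namespace completeSink

open SinkGraph

variable {n : ℕ}

/-! ### Symmetry of the avalanche polynomial -/

theorem Topples.comp_perm {c c' : Fin n → ℕ} {l : List (Fin n)}
    (h : (completeSink n).Topples c l c') (σ : Equiv.Perm (Fin n)) :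
    (completeSink n).Topples (c ∘ σ) (l.map σ.symm) (c' ∘ σ) := by
  induction h with
  | nil c => exact .nil _
  | @cons c c' v l hv h ih =>
    rw [List.map_cons]
    refine .cons (by simpa [deg_eq] using hv) ?_
    convert ih using 1
    funext w
    simp only [topple_apply, Function.comp_apply, Equiv.eq_symm_apply, Equiv.apply_symm_apply]

theorem isRecurrent_comp_perm {c : Fin n → ℕ} (hc : (completeSink n).IsRecurrent c)
    (σ : Equiv.Perm (Fin n)) : (completeSink n).IsRecurrent (c ∘ σ) := by
  rw [isRecurrent_iff] at hc ⊢
  refine ⟨fun w => hc.1 _, ?_⟩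
  have := (dominates_map σ.toEmbedding 0 (c + 1) Finset.univ).1 (by simpa using hc.2)
  exact this

theorem toppled_comp_perm {c : Fin n → ℕ} (hc : (completeSink n).IsRecurrent c) (v : Fin n)
    (σ : Equiv.Perm (Fin n)) :
    toppled (c ∘ σ) (σ.symm v) = (toppled c v).map σ.symm.toEmbedding := by
  obtain ⟨l, c', hl, hs, -, hT, -⟩ := exists_topples_toppled hc v
  have h := Topples.comp_perm hl σ
  have e : (c + Pi.single v 1) ∘ σ = c ∘ σ + Pi.single (σ.symm v) 1 := by
    funext w
    simp [Pi.single_apply, Equiv.eq_symm_apply]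
  rw [e] at h
  have hf := IsTopplingVector.eq_topplingVector _
    (⟨_, _, h, fun w => by simpa [deg_eq] using hs (σ w), fun _ => rfl⟩ :
      (completeSink n).IsTopplingVector _ fun w => (l.map σ.symm).count w)
  change _ = (completeSink n).nu (c ∘ σ) (σ.symm v) at hf
  rw [toppled, ← hf, ← hT]
  ext w
  simp [List.count_pos_iff, Equiv.symm_apply_eq]

/-- The principal avalanches in which exactly the vertices in `T` topple. -/
noncomputable def avalanchesOn (T : Finset (Fin n)) : Finset ((Fin n → ℕ) × Fin n) :=
  ((completeSink n).recurrents ×ˢ Finset.univ).filter fun p => toppled p.1 p.2 = T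

/-- A bijection from `T` to `T'` extends to a permutation of all non-sink vertices, and relabelling
by it is injective on avalanches. -/
theorem card_avalanchesOn_le {T T' : Finset (Fin n)} (h : T.card = T'.card) :
    (avalanchesOn T).card ≤ (avalanchesOn T').card := by
  obtain ⟨σ, hσ⟩ : ∃ σ : Equiv.Perm (Fin n), T.map σ.toEmbedding = T' := by
    let e : {x // x ∈ T} ≃ {x // x ∈ T'} := Finset.equivOfCardEq h
    refine ⟨e.extendSubtype, Finset.eq_of_subset_of_card_le ?_ (by simp [h])⟩
    intro x hx
    obtain ⟨y, hy, rfl⟩ := Finset.mem_map.1 hx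
    exact e.extendSubtype_mem y hy
  refine Finset.card_le_card_of_injOn (fun p => (p.1 ∘ σ.symm, σ p.2)) ?_ ?_
  · rintro ⟨c, v⟩ hp
    simp only [avalanchesOn, Finset.coe_filter, Finset.mem_product, mem_recurrents,
      Set.mem_ofPred_eq, Finset.mem_univ, and_true] at hp ⊢
    refine ⟨isRecurrent_comp_perm hp.1 _, ?_⟩
    have := toppled_comp_perm hp.1 v σ.symm
    rw [Equiv.symm_symm] at this
    rw [this, hp.2, hσ]
  · rintro ⟨c, v⟩ - ⟨c', v'⟩ - hpq
    rw [Prod.mk.injEq] at hpq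
    exact Prod.ext (σ.symm.surjective.injective_comp_right hpq.1) (σ.injective hpq.2)

theorem card_avalanchesOn_eq {T T' : Finset (Fin n)} (h : T.card = T'.card) :
    (avalanchesOn T).card = (avalanchesOn T').card :=
  le_antisymm (card_avalanchesOn_le h) (card_avalanchesOn_le h.symm)

theorem avalancheCount_eq_sum (m : ℕ) :
    (completeSink n).avalancheCount m =
      ∑ T ∈ Finset.powersetCard m (Finset.univ : Finset (Fin n)), (avalanchesOn T).card := by
  rw [avalancheCount, Finset.card_eq_sum_card_fiberwise (f := fun p => toppled p.1 p.2)
    (t := Finset.powersetCard m Finset.univ)]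
  · refine Finset.sum_congr rfl fun T hT => congrArg _ ?_
    rw [Finset.mem_powersetCard] at hT
    ext p
    rw [Finset.mem_filter, mem_avalanches, avalanchesOn, Finset.mem_filter, Finset.mem_product,
      mem_recurrents]
    constructor
    · rintro ⟨⟨h1, -⟩, h2⟩
      exact ⟨⟨h1, Finset.mem_univ _⟩, h2⟩
    · rintro ⟨⟨h1, -⟩, h2⟩
      exact ⟨⟨h1, h2 ▸ hT.2⟩, h2⟩
  · intro p hp
    simp only [Finset.mem_coe, Finset.mem_powersetCard, Finset.subset_univ, true_and]
    exact (mem_avalanches.1 hp).2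

theorem card_avalanchesOn {m : ℕ} {T : Finset (Fin n)} (hT : T.card = m) :
    ((avalanchesOn T).card : ℚ) = ((completeSink n).avalancheCount m : ℚ) / (n.choose m : ℚ) := by
  have hm : m ≤ n := by simpa [hT] using Finset.card_le_univ T
  have hpos : (n.choose m : ℚ) ≠ 0 := by exact_mod_cast (Nat.choose_pos hm).ne'
  rw [eq_div_iff hpos, avalancheCount_eq_sum, Finset.sum_congr rfl fun T' hT' =>
    card_avalanchesOn_eq ((Finset.mem_powersetCard.1 hT').2.trans hT.symm)]
  simp [mul_comm]

/-- Each avalanche contributes the squarefree monomial of its toppled set `T`. Grouping by `T`, the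
coefficient depends only on `T.card = m`, so it is `λ_m` shared equally among the `n.choose m` sets.
-/
theorem avalanchePolynomial_eq (n : ℕ) :
    (completeSink n).avalanchePolynomial =
      ∑ m ∈ Finset.range (n + 1),
        MvPolynomial.C (((completeSink n).avalancheCount m : ℚ) / (n.choose m : ℚ)) *
          MvPolynomial.esymm (Fin n) ℚ m := by
  have h1 : (completeSink n).avalanchePolynomial =
      ∑ p ∈ (completeSink n).recurrents ×ˢ Finset.univ,
        ∏ i ∈ toppled p.1 p.2, (MvPolynomial.X i : MvPolynomial (Fin n) ℚ) := by
    rw [avalanchePolynomial, Finset.sum_product]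
    refine Finset.sum_congr rfl fun c hc => Finset.sum_congr rfl fun v _ => ?_
    simp only [nu_eq_ite ((mem_recurrents _).1 hc), pow_ite, pow_one, pow_zero,
      Finset.prod_ite_mem, Finset.univ_inter]
  have h2 : (completeSink n).avalanchePolynomial =
      ∑ T : Finset (Fin n), (MvPolynomial.C ((avalanchesOn T).card : ℚ)) *
        ∏ i ∈ T, (MvPolynomial.X i : MvPolynomial (Fin n) ℚ) := by
    rw [h1, ← Finset.sum_fiberwise _ fun p => toppled p.1 p.2]
    refine Finset.sum_congr rfl fun T _ => ?_
    rw [Finset.sum_congr rfl fun p hp => by rw [(Finset.mem_filter.1 hp).2], Finset.sum_const,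
      nsmul_eq_mul, map_natCast]
    rfl
  rw [h2, ← Finset.powerset_univ, Finset.sum_powerset, Finset.card_univ, Fintype.card_fin]
  refine Finset.sum_congr rfl fun m _ => ?_
  rw [MvPolynomial.esymm, Finset.mul_sum]
  refine Finset.sum_congr rfl fun T hT => ?_
  rw [card_avalanchesOn (Finset.mem_powersetCard.1 hT).2]

end completeSink

theorem mainTheorem2 (n : ℕ) :
    (completeSink n).avalanchePolynomial =
        ∑ m ∈ Finset.range (n + 1),
          MvPolynomial.C (((completeSink n).avalancheCount m : ℚ) / (n.choose m : ℚ)) *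
            MvPolynomial.esymm (Fin n) ℚ m ∧
      ∀ m : ℕ, 1 ≤ m → m ≤ n →
        (∃ φ : {p : (Fin n → ℕ) × Fin n // p ∈ (completeSink n).avalanches m} ≃
            AvalancheTuple n m, ∀ p, (φ p).IsPhi p.1.1 p.1.2) ∧
        ((completeSink n).avalancheCount m : ℚ) =
          (n.choose m : ℚ) * (m : ℚ) ^ (m - 1) *
            ((n : ℚ) - (m : ℚ) + 1) ^ ((n : ℤ) - (m : ℤ) - 1) :=
  ⟨completeSink.avalanchePolynomial_eq n, fun _ hm hmn =>
    ⟨completeSink.exists_equiv_isPhi hm, completeSink.avalancheCount_eq_rat hm hmn⟩⟩
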